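/- Let $\mathbb{K}$ be a field, let $n\ge 1$ and $d\ge 1$ be integers, write $\underline t=(t_1,\dots,t_n)$, $\underline X=(X_1,\dots,X_{n+1})$, and let $f_{d-1},f_d\in\mathbb{K}[\underline t]$ be homogeneous polynomials of degrees $d-1$ and $d$ without common factors. Consider the monoid parametrization $\theta\mapsto(\theta_1f_{d-1}(\theta):\dots:\theta_nf_{d-1}(\theta):f_d(\theta))$, let $\mathcal I=\langle t_1f_{d-1},\dots,t_nf_{d-1},f_d\rangle\subset\mathbb{K}[\underline t]$, and let $\mathcal K$ be the defining ideal of its Rees algebra, that is, the kernel of the $\mathbb{K}[\underline t]$-algebra morphism $\mathbb{K}[\underline t,\underline X]\to\mathrm{Rees}(\mathcal I)=\mathbb{K}[\underline t][\mathcal I Z]$ with $X_i\mapsto t_if_{d-1}Z$ for $i\le n$ and $X_{n+1}\mapsto f_dZ$. Put $E(\underline X)=f_{d-1}(X_1,\dots,X_n)X_{n+1}-f_d(X_1,\dots,X_n)$. This is the implicit equation of the parametrized hypersurface: $E$ is irreducible and generates the ideal of all $P\in\mathbb{K}[\underline X]$ with $P(t_1f_{d-1},\dots,t_nf_{d-1},f_d)=0$.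 Let $p_{i,j}=t_iX_j-t_jX_i$ for $1\le i<j\le n$, and construct $F_{d-1},\dots,F_0$ as follows. Write $f_d=\sum_{j=1}^n t_jf_{d,j}$ with $f_{d,j}\in\mathbb{K}[\underline t]$ homogeneous of degree $d-1$ and set $F_{d-1}=f_{d-1}X_{n+1}-\sum_{j=1}^n f_{d,j}X_j$. For $j=d-1,d-2,\dots,1$, write $F_j=\sum_{i=1}^n F_{j,i}t_i$ with $F_{j,i}\in\mathbb{K}[\underline t,\underline X]$ bihomogeneous of degree $j-1$ in $\underline t$ and $d-j$ in $\underline X$, and set $F_{j-1}=\sum_{i=1}^n F_{j,i}X_i$. Such decompositions can be chosen at every step, and, whatever the choices, $F_0=E$ and $$\{p_{i,j},\ 1\le i<j\le n,\ F_0,F_1,\dots,F_{d-1}\}$$ is a minimal set of generators of $\mathcal K$: it generates $\mathcal K$, and none of the listed elements lies in the ideal generated by the others. -/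

import Mathlib

open MvPolynomial

noncomputable section

namespace MonoidRees

variable {K : Type*} [Field K] {n : ℕ}

/-- The ring `K[t, X] = K[t_1, …, t_n, X_1, …, X_{n+1}]`: `Sum.inl i` indexes the variables `t`,
`Sum.inr k` the variables `X`. -/
abbrev TX (K : Type*) [Field K] (n : ℕ) : Type _ := MvPolynomial (Fin n ⊕ Fin (n + 1)) K

/-- The variable `t_i`. -/
def tVar (K : Type*) [Field K] {n : ℕ} (i : Fin n) : TX K n := X (Sum.inl i)

/-- The variable `X_k`, `k = 1, …, n + 1`. -/
def xVar (K : Type*) [Field K] {n : ℕ} (k : Fin (n + 1)) : TX K n := X (Sum.inr k)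

/-- A polynomial in `t`, seen in `K[t, X]`. -/
def ofT (p : MvPolynomial (Fin n) K) : TX K n := rename Sum.inl p

/-- A polynomial in `X`, seen in `K[t, X]`. -/
def ofX (p : MvPolynomial (Fin (n + 1)) K) : TX K n := rename Sum.inr p

/-- Bihomogeneous of bidegree `(i, j)`: degree `i` in `t` and degree `j` in `X`. -/
def IsBihomogeneous (p : TX K n) (i j : ℕ) : Prop :=
  IsWeightedHomogeneous (Sum.elim (fun _ => 1) (fun _ => 0) : Fin n ⊕ Fin (n + 1) → ℕ) p i ∧
  IsWeightedHomogeneous (Sum.elim (fun _ => 0) (fun _ => 1) : Fin n ⊕ Fin (n + 1) → ℕ) p j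

/-- The map `K[t, X] → Rees(I) = K[t][I Z]`, `t_i ↦ t_i`, `X_k ↦ u_k Z`,
where `I = ⟨u_1, …, u_{n+1}⟩`. -/
def reesMap (u : Fin (n + 1) → MvPolynomial (Fin n) K) :
    TX K n →ₐ[K] reesAlgebra (Ideal.span (Set.range u)) :=
  aeval (Sum.elim
    (fun i => algebraMap (MvPolynomial (Fin n) K) (reesAlgebra (Ideal.span (Set.range u))) (X i))
    (fun k => ⟨Polynomial.monomial 1 (u k), reesAlgebra.monomial_mem.mpr
      (by rw [pow_one]; exact Ideal.subset_span ⟨k, rfl⟩)⟩))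

/-- The defining ideal of the Rees algebra of `I = ⟨u_1, …, u_{n+1}⟩`. -/
def reesIdeal (u : Fin (n + 1) → MvPolynomial (Fin n) K) : Ideal (TX K n) :=
  RingHom.ker (reesMap u)

/-- The monoid parametrization `(t_1 f : … : t_n f : g)`, with `f = f_{d-1}` and `g = f_d`. -/
def monoidParam (f g : MvPolynomial (Fin n) K) : Fin (n + 1) → MvPolynomial (Fin n) K :=
  Fin.snoc (α := fun _ => MvPolynomial (Fin n) K) (fun i => X i * f) g

/-- `E = f(X_1, …, X_n) X_{n+1} - g(X_1, …, X_n)`. -/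
def monoidEquation (f g : MvPolynomial (Fin n) K) : MvPolynomial (Fin (n + 1)) K :=
  rename Fin.castSucc f * X (Fin.last n) - rename Fin.castSucc g

/-- `E` is the implicit equation of the hypersurface parametrized by `u`: it is irreducible and
generates the ideal of all `P ∈ K[X]` with `P(u_1, …, u_{n+1}) = 0`. -/
def IsImplicitEquation (u : Fin (n + 1) → MvPolynomial (Fin n) K)
    (E : MvPolynomial (Fin (n + 1)) K) : Prop :=
  Irreducible E ∧ RingHom.ker (aeval u : MvPolynomial (Fin (n + 1)) K →ₐ[K] _) = Ideal.span {E}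

/-- `p_{ij} = t_i X_j - t_j X_i`. -/
def minor (K : Type*) [Field K] {n : ℕ} (i j : Fin n) : TX K n :=
  tVar K i * xVar K j.castSucc - tVar K j * xVar K i.castSucc

/-- `F_0, …, F_{d-1}` (the values `F j` with `j ≥ d` play no role) is a sequence produced by the
recursive construction from `f = f_{d-1}` and `g = f_d`, for some choice of the homogeneous
decompositions made at each step. -/
structure IsMonoidSequence (d : ℕ) (f g : MvPolynomial (Fin n) K) (F : ℕ → TX K n) : Prop where
  start : ∃ a : Fin n → MvPolynomial (Fin n) K,
    (∀ i, (a i).IsHomogeneous (d - 1)) ∧ g = ∑ i, X i * a i ∧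
    F (d - 1) = ofT f * xVar K (Fin.last n) - ∑ i, ofT (a i) * xVar K i.castSucc
  step : ∀ j, j + 1 < d → ∃ G : Fin n → TX K n,
    (∀ i, IsBihomogeneous (G i) j (d - (j + 1))) ∧
    F (j + 1) = ∑ i, G i * tVar K i ∧
    F j = ∑ i, G i * xVar K i.castSucc

/-- The family of all `p_{ij}`, `i < j`, followed by `F_0, …, F_{d-1}`. -/
def monoidGenerators (d : ℕ) (F : ℕ → TX K n) :
    {q : Fin n × Fin n // q.1 < q.2} ⊕ Fin d → TX K n :=
  Sum.elim (fun q => minor K q.1.1 q.1.2) (fun j => F j)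

/-- The family `s` generates the ideal `J`, and no member is in the ideal generated by the members
with other indices (in particular the members are pairwise distinct). -/
def IsMinimalGenerators {R ι : Type*} [CommRing R] (J : Ideal R) (s : ι → R) : Prop :=
  Ideal.span (Set.range s) = J ∧ ∀ a, s a ∉ Ideal.span (s '' {a}ᶜ)

end MonoidRees

end

/-! ### Weighted homogeneous polynomials. -/

section WeightedHomogeneous

variable {σ τ R M N : Type*} [CommSemiring R]

/-! Everything is read through the substitution `collapse`: t_i ↦ X_i. Write u for the
parametrization. If p has bidegree (a, b), then evaluating `collapse p` at u gives f^a · p(t, u)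
(`aeval_monoidParam_collapse`), because u_i = t_i f for i ≤ n. As f ≠ 0 and E generates the ideal of
relations among the u_k, a bihomogeneous p lies in the Rees ideal iff E divides `collapse p`
(`mem_reesIdeal_iff_dvd_collapse`).

Two more facts give generation. On a fixed bidegree the kernel of `collapse` lies in the ideal of
the p_{ij} (`mem_minorIdeal_of_collapse_eq_zero`). Every F_j collapses to E, since trading a t_i for
X_i is invisible to `collapse`. So if `collapse p` = Q E, it suffices to lift each monomial of Q to
a bidegree complementary to that of a suitable F_m: the sum of the products has the same collapse as
p, and the difference is a combination of the p_{ij}.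

Minimality is a count of bidegrees. The F_j have the pairwise incomparable bidegrees (j, d - j), and
the p_{ij} collapse to 0 while F_j does not. In bidegree (1, 1), only F_{d-1} could help to express
a p_{ij}; collapsing shows that its coefficient vanishes, and a point evaluation separates the
p_{ij}. -/

theorem weightedHomogeneousComponent_add_mul [AddCancelCommMonoid M] {w : σ → M}
    {ψ : MvPolynomial σ R} {m : M} (hψ : IsWeightedHomogeneous w ψ m) (k : M)
    (φ : MvPolynomial σ R) :
    weightedHomogeneousComponent w (k + m) (φ * ψ) =
      weightedHomogeneousComponent w k φ * ψ := by
  classical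
  induction φ using MvPolynomial.induction_on' with
  | add p q hp hq => simp only [add_mul, map_add, hp, hq]
  | monomial e r =>
    have he := isWeightedHomogeneous_monomial w e r rfl
    rw [weightedHomogeneousComponent_of_mem (he.mul hψ),
      weightedHomogeneousComponent_of_mem he]
    by_cases h : k = Finsupp.weight w e <;> simp [h]

theorem weightedHomogeneousComponent_mul_eq_zero [AddCommMonoid M] {w : σ → M}
    {ψ : MvPolynomial σ R} {m D : M} (hψ : IsWeightedHomogeneous w ψ m) (hD : ∀ k, k + m ≠ D)
    (φ : MvPolynomial σ R) :
    weightedHomogeneousComponent w D (φ * ψ) = 0 := by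
  classical
  induction φ using MvPolynomial.induction_on' with
  | add p q hp hq => simp only [add_mul, map_add, hp, hq, add_zero]
  | monomial e r =>
    have he := isWeightedHomogeneous_monomial w e r rfl
    rw [weightedHomogeneousComponent_of_mem (he.mul hψ),
      if_neg (hD _).symm]

theorem isWeightedHomogeneous_aeval [AddCommMonoid M] [AddCommMonoid N] {w : σ → M} {w' : τ → N}
    (φ : M →+ N) {v : σ → MvPolynomial τ R} (hv : ∀ k, IsWeightedHomogeneous w' (v k) (φ (w k)))
    {p : MvPolynomial σ R} {D : M} (hp : IsWeightedHomogeneous w p D) :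
    IsWeightedHomogeneous w' (aeval v p) (φ D) := by
  induction hp using IsWeightedHomogeneous.induction_on with
  | zero => simpa using isWeightedHomogeneous_zero R w' _
  | add p q _ _ hp hq => simpa using hp.add hq
  | monomial e r he =>
    rw [aeval_monomial, ← he, Finsupp.weight_apply, map_finsuppSum]
    refine IsWeightedHomogeneous.C_mul (IsWeightedHomogeneous.prod _ _ _ fun k _ => ?_) r
    simpa using (hv k).pow (e k)

theorem isWeightedHomogeneous_rename [AddCommMonoid M] [AddCommMonoid N] {w : σ → M} {w' : τ → N}
    (φ : M →+ N) {c : σ → τ} (hc : ∀ k, w' (c k) = φ (w k))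
    {p : MvPolynomial σ R} {D : M} (hp : IsWeightedHomogeneous w p D) :
    IsWeightedHomogeneous w' (rename c p) (φ D) := by
  have : rename c = aeval (R := R) (X ∘ c) := by ext; simp
  rw [this]
  exact isWeightedHomogeneous_aeval φ (fun k => hc k ▸ isWeightedHomogeneous_X R w' (c k)) hp

/-- Euler scaling, used with three kinds of scalar: c = f compares the two substitutions, c = Z
computes the Rees map, and c = 0 detects polynomials free of a block of variables. -/
theorem aeval_pow_mul {A : Type*} [CommSemiring A] [Algebra R A] {w : σ → ℕ} (c : A) (v : σ → A)
    {p : MvPolynomial σ R} {D : ℕ} (hp : IsWeightedHomogeneous w p D) :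
    aeval (fun k => c ^ w k * v k) p = c ^ D * aeval v p := by
  induction hp using IsWeightedHomogeneous.induction_on with
  | zero => simp
  | add p q _ _ hp hq => simp only [map_add, hp, hq, mul_add]
  | monomial e r he =>
    have : (e.prod fun k l => (c ^ w k) ^ l) = c ^ D := by
      rw [← he, Finsupp.weight_apply, Finsupp.sum, Finsupp.prod, ← Finset.prod_pow_eq_pow_sum]
      exact Finset.prod_congr rfl fun k _ => by rw [← pow_mul, smul_eq_mul, mul_comm]
    simp only [aeval_monomial, mul_pow, Finsupp.prod_mul, this]
    ring

theorem exists_eq_sum_mul_X [AddCancelCommMonoid M] {ι : Type*} [Fintype ι] {w : σ → M} {δ D : M}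
    (v : ι → σ) (hv : ∀ i, w (v i) = δ)
    (hD : ∀ m : σ →₀ ℕ, Finsupp.weight w m = D + δ → ∃ i, m (v i) ≠ 0)
    {p : MvPolynomial σ R} (hp : IsWeightedHomogeneous w p (D + δ)) :
    ∃ G : ι → MvPolynomial σ R, (∀ i, IsWeightedHomogeneous w (G i) D) ∧
      p = ∑ i, G i * X (v i) := by
  classical
  induction hp using IsWeightedHomogeneous.induction_on with
  | zero => exact ⟨0, fun i => isWeightedHomogeneous_zero R w _, by simp⟩
  | add p q _ _ hp hq =>
    obtain ⟨G, hG, rfl⟩ := hp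
    obtain ⟨H, hH, rfl⟩ := hq
    exact ⟨G + H, fun i => (hG i).add (hH i), by simp [add_mul, Finset.sum_add_distrib]⟩
  | monomial e r he =>
    obtain ⟨i, hi⟩ := hD e he
    have hle : Finsupp.single (v i) 1 ≤ e := by
      rw [Finsupp.single_le_iff]; omega
    have hsub := tsub_add_cancel_of_le hle
    refine ⟨fun k => if k = i then monomial (e - Finsupp.single (v i) 1) r else 0,
      fun k => ?_, ?_⟩
    · dsimp only
      split_ifs
      · apply isWeightedHomogeneous_monomial
        rw [← hsub, map_add, Finsupp.weight_single, one_smul, hv] at he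
        exact add_right_cancel he
      · exact isWeightedHomogeneous_zero R w _
    · simp only [ite_mul, zero_mul, Finset.sum_ite_eq', Finset.mem_univ, if_true]
      rw [X, monomial_mul, mul_one, hsub]

end WeightedHomogeneous

/-- Over a domain the degree in each variable is additive, so a divisor of `rename c f` involves
only variables in the range of `c`; `killCompl` then carries divisibility back. -/
theorem isRelPrime_rename {σ τ R : Type*} [CommRing R] [IsDomain R] {c : σ → τ}
    (hc : Function.Injective c) {f g : MvPolynomial σ R} (hf : f ≠ 0) (h : IsRelPrime f g) :
    IsRelPrime (rename c f) (rename c g) := by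
  classical
  intro a haf hag
  obtain ⟨b, hb⟩ := haf
  have hne : a ≠ 0 ∧ b ≠ 0 := by
    rw [← mul_ne_zero_iff, ← hb]
    exact (map_ne_zero_iff _ (rename_injective c hc)).mpr hf
  have hvars : (a.vars : Set τ) ⊆ Set.range c := by
    intro k hk
    by_contra hk'
    have h0 : degreeOf k (rename c f) = 0 := by
      by_contra h0
      obtain ⟨j, -, rfl⟩ := mem_vars_rename _ _ (mem_vars_iff_degreeOf_ne_zero.mpr h0)
      exact hk' ⟨j, rfl⟩
    rw [hb, degreeOf_mul_eq hne.1 hne.2] at h0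
    have := mem_vars_iff_degreeOf_ne_zero.mp hk
    omega
  obtain ⟨a, rfl⟩ := exists_rename_eq_of_vars_subset_range a c hc hvars
  have hk (p q : MvPolynomial σ R) (hpq : rename c p ∣ rename c q) : p ∣ q := by
    simpa only [killCompl_rename_app] using map_dvd (killCompl hc) hpq
  exact (h (hk _ _ ⟨b, hb⟩) (hk _ _ hag)).map (rename c)

/-! ### The bigrading of K[t, X] and the collapse t_i ↦ X_i. -/

noncomputable section

namespace MonoidRees

variable {K : Type*} [Field K] {n : ℕ}

/-- The `ℕ × ℕ`-valued weights of the variables: `t_i` has weight `(1, 0)`, `X_k` has `(0, 1)`. -/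
def bidegree (n : ℕ) : Fin n ⊕ Fin (n + 1) → ℕ × ℕ :=
  Sum.elim (fun _ => (1, 0)) (fun _ => (0, 1))

theorem weight_bidegree (m : Fin n ⊕ Fin (n + 1) →₀ ℕ) :
    Finsupp.weight (bidegree n) m = (∑ i, m (Sum.inl i), ∑ k, m (Sum.inr k)) := by
  rw [Finsupp.weight_apply, Finsupp.sum_fintype _ _ (by simp), Fintype.sum_sum_type]
  ext <;> simp [bidegree, Prod.fst_sum, Prod.snd_sum]

theorem isBihomogeneous_iff {p : TX K n} {i j : ℕ} :
    IsBihomogeneous p i j ↔ IsWeightedHomogeneous (bidegree n) p (i, j) := by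
  have h (m : Fin n ⊕ Fin (n + 1) →₀ ℕ) : Finsupp.weight (bidegree n) m =
      (Finsupp.weight (Sum.elim (fun _ => 1) (fun _ => 0) : Fin n ⊕ Fin (n + 1) → ℕ) m,
        Finsupp.weight (Sum.elim (fun _ => 0) (fun _ => 1) : Fin n ⊕ Fin (n + 1) → ℕ) m) := by
    rw [weight_bidegree]
    simp [Finsupp.weight_apply, Finsupp.sum_fintype, Fintype.sum_sum_type]
  simp only [IsBihomogeneous, IsWeightedHomogeneous, h, Prod.mk.injEq]
  exact ⟨fun hp m hm => ⟨hp.1 hm, hp.2 hm⟩, fun hp => ⟨fun m hm => (hp hm).1, fun m hm => (hp hm).2⟩⟩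

theorem isWeightedHomogeneous_tVar (i : Fin n) :
    IsWeightedHomogeneous (bidegree n) (tVar K i) (1, 0) :=
  isWeightedHomogeneous_X K (bidegree n) (Sum.inl i)

theorem isWeightedHomogeneous_xVar (k : Fin (n + 1)) :
    IsWeightedHomogeneous (bidegree n) (xVar K k) (0, 1) :=
  isWeightedHomogeneous_X K (bidegree n) (Sum.inr k)

theorem isWeightedHomogeneous_minor (i j : Fin n) :
    IsWeightedHomogeneous (bidegree n) (minor K i j) (1, 1) :=
  ((isWeightedHomogeneous_tVar i).mul (isWeightedHomogeneous_xVar j.castSucc)).sub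
    ((isWeightedHomogeneous_tVar j).mul (isWeightedHomogeneous_xVar i.castSucc))

theorem isWeightedHomogeneous_ofT {p : MvPolynomial (Fin n) K} {a : ℕ} (hp : p.IsHomogeneous a) :
    IsWeightedHomogeneous (bidegree n) (ofT p) (a, 0) :=
  isWeightedHomogeneous_rename (w := 1) (w' := bidegree n) (c := Sum.inl) (AddMonoidHom.inl ℕ ℕ)
    (fun _ => rfl) hp

/-- The substitution `t_i ↦ X_i`, which fixes every `X_k`. -/
def collapse (K : Type*) [Field K] (n : ℕ) : TX K n →ₐ[K] MvPolynomial (Fin (n + 1)) K :=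
  rename (Sum.elim Fin.castSucc id)

@[simp]
theorem collapse_tVar (i : Fin n) : collapse K n (tVar K i) = X i.castSucc := by
  simp [collapse, tVar]

@[simp]
theorem collapse_xVar (k : Fin (n + 1)) : collapse K n (xVar K k) = X k := by
  simp [collapse, xVar]

@[simp]
theorem collapse_ofT (p : MvPolynomial (Fin n) K) :
    collapse K n (ofT p) = rename Fin.castSucc p := by
  simp only [collapse, ofT, rename_rename]; rfl

@[simp]
theorem collapse_minor (i j : Fin n) : collapse K n (minor K i j) = 0 := by
  simp [minor, mul_comm]

theorem isHomogeneous_collapse {p : TX K n} {a b : ℕ}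
    (hp : IsWeightedHomogeneous (bidegree n) p (a, b)) : (collapse K n p).IsHomogeneous (a + b) :=
  isWeightedHomogeneous_rename (w' := 1) (AddMonoidHom.coprod (.id ℕ) (.id ℕ))
    (by rintro (i | k) <;> rfl) hp

theorem exists_eq_sum_mul_tVar {p : TX K n} {a b : ℕ}
    (hp : IsWeightedHomogeneous (bidegree n) p (a + 1, b)) :
    ∃ G : Fin n → TX K n, (∀ i, IsWeightedHomogeneous (bidegree n) (G i) (a, b)) ∧
      p = ∑ i, G i * tVar K i := by
  refine exists_eq_sum_mul_X (D := (a, b)) (δ := (1, 0)) Sum.inl (fun _ => rfl) (fun m hm => ?_) hp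
  by_contra! h
  simp [weight_bidegree, h] at hm

theorem exists_eq_sum_X_mul {p : MvPolynomial (Fin n) K} {a : ℕ} (hp : p.IsHomogeneous (a + 1)) :
    ∃ G : Fin n → MvPolynomial (Fin n) K, (∀ i, (G i).IsHomogeneous a) ∧ p = ∑ i, X i * G i := by
  obtain ⟨G, hG, h⟩ := exists_eq_sum_mul_X (D := a) (δ := 1) (w := 1) id (fun _ => rfl)
    (fun m hm => by
      by_contra! h
      simp only [id_eq] at h
      simp [Finsupp.weight_apply, Finsupp.sum_fintype, h] at hm) hp
  exact ⟨G, hG, by simpa only [mul_comm, id_eq] using h⟩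

theorem isWeightedHomogeneous_sum_mul_xVar {G : Fin n → TX K n} {a b : ℕ}
    (hG : ∀ i, IsWeightedHomogeneous (bidegree n) (G i) (a, b)) :
    IsWeightedHomogeneous (bidegree n) (∑ i, G i * xVar K i.castSucc) (a, b + 1) :=
  IsWeightedHomogeneous.sum _ _ _ fun i _ => (hG i).mul (isWeightedHomogeneous_xVar i.castSucc)

/-- Bidegree can be moved from `t` to `X` without changing the collapse. -/
theorem exists_collapse_eq {a b c : ℕ} {p : TX K n}
    (hp : IsWeightedHomogeneous (bidegree n) p (a + b, c)) :
    ∃ q : TX K n, IsWeightedHomogeneous (bidegree n) q (a, b + c) ∧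
      collapse K n q = collapse K n p := by
  induction b generalizing c p with
  | zero => exact ⟨p, by simpa using hp, rfl⟩
  | succ b ih =>
    obtain ⟨G, hG, rfl⟩ := exists_eq_sum_mul_tVar (a := a + b) hp
    obtain ⟨q, hq, h⟩ := ih (isWeightedHomogeneous_sum_mul_xVar hG)
    refine ⟨q, by rwa [add_right_comm, add_assoc], h.trans ?_⟩
    simp

/-! ### The kernel of the collapse in a fixed bidegree. -/

/-- The ideal of all `p_{ij}`. -/
def minorIdeal (K : Type*) [Field K] (n : ℕ) : Ideal (TX K n) :=
  Ideal.span (Set.range fun q : {q : Fin n × Fin n // q.1 < q.2} => minor K q.1.1 q.1.2)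

theorem minor_mem_minorIdeal (i j : Fin n) : minor K i j ∈ minorIdeal K n := by
  rcases lt_trichotomy i j with h | rfl | h
  · exact Ideal.subset_span ⟨⟨(i, j), h⟩, rfl⟩
  · simp [minor]
  · rw [show minor K i j = -minor K j i by simp [minor]]
    exact neg_mem (Ideal.subset_span ⟨⟨(j, i), h⟩, rfl⟩)

/-- Exchange argument: where m has too many t_i it has too few t_j for some j, and then X_j divides
it. Replacing t_i X_j by t_j X_i costs a multiple of p_{ij} and lowers the total excess of m over m'
in the t-exponents. -/
theorem monomial_sub_monomial_mem_minorIdeal {m m' : Fin n ⊕ Fin (n + 1) →₀ ℕ}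
    (ht : ∑ i, m (Sum.inl i) = ∑ i, m' (Sum.inl i))
    (hx : ∀ i : Fin n, m (Sum.inl i) + m (Sum.inr i.castSucc) =
      m' (Sum.inl i) + m' (Sum.inr i.castSucc))
    (hl : m (Sum.inr (Fin.last n)) = m' (Sum.inr (Fin.last n))) :
    monomial m (1 : K) - monomial m' 1 ∈ minorIdeal K n := by
  classical
  induction hN : ∑ i, (m (Sum.inl i) - m' (Sum.inl i)) using Nat.strong_induction_on
    generalizing m with
  | _ N ih =>
  by_cases hle : ∀ i, m (Sum.inl i) ≤ m' (Sum.inl i)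
  · have heq := (Finset.sum_eq_sum_iff_of_le fun i _ => hle i).mp ht
    have : m = m' := by
      ext (i | k)
      · exact heq i (Finset.mem_univ i)
      · induction k using Fin.lastCases with
        | last => exact hl
        | cast i => have := heq i (Finset.mem_univ i); have := hx i; omega
    simp [this]
  push Not at hle
  obtain ⟨i, hi⟩ := hle
  obtain ⟨j, hj⟩ : ∃ j, m (Sum.inl j) < m' (Sum.inl j) := by
    by_contra! h
    exact (Finset.sum_lt_sum (fun k _ => h k) ⟨i, Finset.mem_univ i, hi⟩).ne' ht
  have hij : i ≠ j := by rintro rfl; omega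
  obtain ⟨r, hr⟩ : ∃ r, m = r + (Finsupp.single (Sum.inl i) 1 +
      Finsupp.single (Sum.inr j.castSucc) 1) := by
    refine ⟨_, (tsub_add_cancel_of_le ?_).symm⟩
    rintro (k | k)
    · rcases eq_or_ne k i with rfl | h
      · simp; omega
      · simp [h.symm]
    · rcases eq_or_ne k j.castSucc with rfl | h
      · have := hx j; simp; omega
      · simp [h.symm]
  set m₁ := r + (Finsupp.single (Sum.inl j) 1 + Finsupp.single (Sum.inr i.castSucc) 1)
  have hinl (k : Fin n) : m₁ (Sum.inl k) = r (Sum.inl k) + if k = j then 1 else 0 := by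
    simp [m₁, Finsupp.single_apply, eq_comm]
  have hinr (k : Fin n) : m₁ (Sum.inr k.castSucc) =
      r (Sum.inr k.castSucc) + if k = i then 1 else 0 := by
    simp [m₁, Finsupp.single_apply, eq_comm]
  have hstep : monomial m (1 : K) - monomial m₁ 1 ∈ minorIdeal K n := by
    have : monomial m (1 : K) - monomial m₁ 1 = monomial r 1 * minor K i j := by
      simp [hr, m₁, minor, tVar, xVar, X, mul_sub, monomial_mul]
    rw [this]
    exact Ideal.mul_mem_left _ _ (minor_mem_minorIdeal i j)
  have hinl' (k : Fin n) : m (Sum.inl k) = r (Sum.inl k) + if k = i then 1 else 0 := by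
    simp [hr, Finsupp.single_apply, eq_comm]
  have hinr' (k : Fin n) : m (Sum.inr k.castSucc) =
      r (Sum.inr k.castSucc) + if k = j then 1 else 0 := by
    simp [hr, Finsupp.single_apply, eq_comm]
  have hlast : m₁ (Sum.inr (Fin.last n)) = m (Sum.inr (Fin.last n)) := by
    simp [hr, m₁]
  simp only [hinl', hinr'] at ht hx hi hj hN
  suffices key : monomial m₁ (1 : K) - monomial m' 1 ∈ minorIdeal K n by
    simpa using add_mem hstep key
  refine ih (∑ k, (m₁ (Sum.inl k) - m' (Sum.inl k))) ?_ ?_ ?_ ?_ rfl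
  · rw [← hN]
    refine Finset.sum_lt_sum (fun k _ => ?_) ⟨i, Finset.mem_univ i, ?_⟩
    · rw [hinl]
      by_cases hk : k = j
      · subst hk; simp [hij.symm] at hj ⊢; omega
      · simp [hk]; omega
    · simp [hinl, hij] at hi ⊢; omega
  · rw [← ht]
    simp [hinl, Finset.sum_add_distrib]
  · intro k
    rw [hinl, hinr, ← hx k]; ring
  · rw [hlast, hl]

theorem sum_elim_mapDomain_castSucc (m : Fin n ⊕ Fin (n + 1) →₀ ℕ) (i : Fin n) :
    m.mapDomain (Sum.elim Fin.castSucc id) i.castSucc =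
      m (Sum.inl i) + m (Sum.inr i.castSucc) := by
  classical
  simp [Finsupp.mapDomain, Finsupp.sum_fintype, Finsupp.single_apply]

theorem sum_elim_mapDomain_last (m : Fin n ⊕ Fin (n + 1) →₀ ℕ) :
    m.mapDomain (Sum.elim Fin.castSucc id) (Fin.last n) = m (Sum.inr (Fin.last n)) := by
  classical
  simp [Finsupp.mapDomain, Finsupp.sum_fintype, Finsupp.single_apply, (Fin.castSucc_lt_last _).ne]

/-- Choosing one monomial of bidegree D above each monomial in X gives a linear section `L`. Modulo
the p_{ij}, every p of bidegree D equals `L (collapse p)`. -/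
theorem mem_minorIdeal_of_collapse_eq_zero {p : TX K n} {D : ℕ × ℕ}
    (hp : IsWeightedHomogeneous (bidegree n) p D) (h : collapse K n p = 0) :
    p ∈ minorIdeal K n := by
  classical
  -- The default 0 is harmless: `s` only matters at collapses of monomials of bidegree D.
  let s (e : Fin (n + 1) →₀ ℕ) : Fin n ⊕ Fin (n + 1) →₀ ℕ :=
    if h : ∃ m, Finsupp.weight (bidegree n) m = D ∧ m.mapDomain (Sum.elim Fin.castSucc id) = e
    then h.choose else 0
  let L : MvPolynomial (Fin (n + 1)) K →ₗ[K] TX K n :=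
    (basisMonomials (Fin (n + 1)) K).constr K fun e => monomial (s e) (1 : K)
  suffices p - L (collapse K n p) ∈ minorIdeal K n by simpa [h] using this
  clear h
  induction hp using IsWeightedHomogeneous.induction_on with
  | zero => simp
  | add p q _ _ hp hq =>
    rw [map_add, map_add, add_sub_add_comm]
    exact add_mem hp hq
  | monomial m r hm =>
    have hs : ∃ m', Finsupp.weight (bidegree n) m' = D ∧
        m'.mapDomain (Sum.elim Fin.castSucc id) = m.mapDomain (Sum.elim Fin.castSucc id) :=
      ⟨m, hm, rfl⟩
    have hsm : s (m.mapDomain (Sum.elim Fin.castSucc id)) = hs.choose := dif_pos hs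
    obtain ⟨h₁, h₂⟩ := hs.choose_spec
    have hL (e : Fin (n + 1) →₀ ℕ) : L (monomial e r) = C r * monomial (s e) 1 := by
      have := (basisMonomials (Fin (n + 1)) K).constr_basis K (fun e => monomial (s e) (1 : K)) e
      rw [coe_basisMonomials] at this
      rw [← mul_one r, ← smul_eq_mul, ← smul_monomial, map_smul, this, smul_eq_mul, mul_one, C_mul']
    rw [collapse, rename_monomial, hL, hsm, ← mul_one r, ← C_mul_monomial, mul_one, ← mul_sub]
    refine Ideal.mul_mem_left _ _ (monomial_sub_monomial_mem_minorIdeal ?_ ?_ ?_)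
    · have := h₁.trans hm.symm
      rw [weight_bidegree, weight_bidegree] at this
      exact (congrArg Prod.fst this).symm
    · intro i
      rw [← sum_elim_mapDomain_castSucc, ← sum_elim_mapDomain_castSucc, h₂]
    · rw [← sum_elim_mapDomain_last, ← sum_elim_mapDomain_last, h₂]

end MonoidRees

end

noncomputable section

namespace MonoidRees

variable {K : Type*} [Field K] {n : ℕ}

/-! ### The implicit equation. -/

section ImplicitEquation

variable {d : ℕ} {f g : MvPolynomial (Fin n) K}

theorem ne_zero_of_isRelPrime (hd : 1 ≤ d) (hg : g.IsHomogeneous d) (hfg : IsRelPrime f g) :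
    f ≠ 0 := by
  rintro rfl
  have hu : IsUnit g := isRelPrime_zero_left.mp hfg
  have h0 : constantCoeff g = 0 := by
    rw [constantCoeff_eq]
    exact hg.coeff_eq_zero (by simpa using (by omega : 0 ≠ d))
  simpa [h0] using hu.map (constantCoeff (σ := Fin n) (R := K))

theorem last_notMem_vars_rename_castSucc (p : MvPolynomial (Fin n) K) :
    Fin.last n ∉ (rename Fin.castSucc p).vars := by
  intro h
  obtain ⟨i, -, hi⟩ := mem_vars_rename _ _ h
  exact (Fin.castSucc_lt_last i).ne hi

/-- E is linear in X_{n+1} with coprime coefficients. -/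
theorem irreducible_monoidEquation (hf0 : f ≠ 0) (hfg : IsRelPrime f g) :
    Irreducible (monoidEquation f g) := by
  have hinj := Fin.castSucc_injective n
  rw [monoidEquation, sub_eq_add_neg]
  refine irreducible_mul_X_add _ _ _ ((map_ne_zero_iff _ (rename_injective _ hinj)).mpr hf0)
    (last_notMem_vars_rename_castSucc f) ?_ (isRelPrime_rename hinj hf0 hfg).neg_right
  rw [vars_neg]
  exact last_notMem_vars_rename_castSucc g

theorem isHomogeneous_monoidEquation (hd : 1 ≤ d) (hf : f.IsHomogeneous (d - 1))
    (hg : g.IsHomogeneous d) : (monoidEquation f g).IsHomogeneous d := by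
  have := (hf.rename_isHomogeneous (f := Fin.castSucc)).mul (isHomogeneous_X K (Fin.last n))
  rw [Nat.sub_add_cancel hd] at this
  exact this.sub hg.rename_isHomogeneous

theorem one_le_degreeOf_monoidEquation (hf0 : f ≠ 0) :
    1 ≤ degreeOf (Fin.last n) (monoidEquation f g) := by
  obtain ⟨e, he⟩ := exists_coeff_ne_zero hf0
  have hg0 : coeff (e.mapDomain Fin.castSucc + Finsupp.single (Fin.last n) 1)
      (rename Fin.castSucc g) = 0 := by
    by_contra h
    refine last_notMem_vars_rename_castSucc g ((mem_vars_iff_mem_support _).mpr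
      ⟨_, mem_support_iff.mpr h, ?_⟩)
    simp
  have hc : coeff (e.mapDomain Fin.castSucc + Finsupp.single (Fin.last n) 1)
      (monoidEquation f g) ≠ 0 := by
    rwa [monoidEquation, coeff_sub, coeff_mul_X, hg0, sub_zero,
      coeff_rename_mapDomain _ (Fin.castSucc_injective n)]
  refine le_trans ?_ (monomial_le_degreeOf (Fin.last n) (mem_support_iff.mpr hc))
  simp

theorem aeval_X_mul_eq {p : MvPolynomial (Fin n) K} {k : ℕ} (hp : p.IsHomogeneous k) :
    aeval (fun i => X i * f) p = f ^ k * p := by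
  have := aeval_pow_mul (w := 1) f X hp
  simpa [mul_comm] using this

/-- The degree k part is multiplied by f^k and lands in degree dk. Since d ≥ 1 these degrees stay
distinct, which yields injectivity of t_i ↦ t_i f. -/
theorem homogeneousComponent_aeval_X_mul (hd : 1 ≤ d) (hf : f.IsHomogeneous (d - 1)) (k : ℕ)
    (p : MvPolynomial (Fin n) K) :
    homogeneousComponent (d * k) (aeval (fun i => X i * f) p) =
      f ^ k * homogeneousComponent k p := by
  induction p using MvPolynomial.induction_on' with
  | add p q hp hq => simp only [map_add, hp, hq, mul_add]
  | monomial e r =>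
    have he : (monomial e r).IsHomogeneous e.degree := isHomogeneous_monomial r rfl
    have hm := (hf.pow e.degree).mul he
    rw [← Nat.succ_mul, Nat.succ_eq_add_one, Nat.sub_add_cancel hd] at hm
    rw [aeval_X_mul_eq he, homogeneousComponent_of_mem hm, homogeneousComponent_of_mem he]
    by_cases h : k = e.degree
    · simp [h]
    · have hd0 : d ≠ 0 := by omega
      simp [h, hd0]

theorem aeval_X_mul_injective (hd : 1 ≤ d) (hf : f.IsHomogeneous (d - 1)) (hf0 : f ≠ 0) :
    Function.Injective (aeval (R := K) fun i : Fin n => X i * f) := by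
  rw [injective_iff_map_eq_zero]
  intro p hp
  have h (k : ℕ) : homogeneousComponent k p = 0 := by
    have := homogeneousComponent_aeval_X_mul hd hf k p
    rw [hp, map_zero, eq_comm] at this
    exact (mul_eq_zero.mp this).resolve_left (pow_ne_zero k hf0)
  rw [← sum_homogeneousComponent p]
  simp [h]

theorem aeval_monoidParam_rename (p : MvPolynomial (Fin n) K) :
    aeval (monoidParam f g) (rename Fin.castSucc p) = aeval (fun i => X i * f) p := by
  rw [aeval_rename]
  congr 2
  ext1 i
  simp [monoidParam]

theorem aeval_monoidEquation (hd : 1 ≤ d) (hf : f.IsHomogeneous (d - 1)) (hg : g.IsHomogeneous d) :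
    aeval (monoidParam f g) (monoidEquation f g) = 0 := by
  rw [monoidEquation, map_sub, map_mul, aeval_monoidParam_rename, aeval_monoidParam_rename,
    aeval_X_mul_eq hf, aeval_X_mul_eq hg, aeval_X, ← pow_succ, Nat.sub_add_cancel hd]
  simp [monoidParam]

/-- Pseudo-division by E: modulo E, each X_{n+1} is eliminated through f X_{n+1} ≡ g. -/
theorem exists_monoidEquation_dvd (f g : MvPolynomial (Fin n) K)
    (P : MvPolynomial (Fin (n + 1)) K) :
    ∃ (N : ℕ) (Q : MvPolynomial (Fin n) K),
      monoidEquation f g ∣ rename Fin.castSucc f ^ N * P - rename Fin.castSucc Q := by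
  induction P using MvPolynomial.induction_on with
  | C r => exact ⟨0, C r, by simp⟩
  | add P₁ P₂ h₁ h₂ =>
    obtain ⟨N₁, Q₁, A₁, h₁⟩ := h₁
    obtain ⟨N₂, Q₂, A₂, h₂⟩ := h₂
    refine ⟨N₁ + N₂, f ^ N₂ * Q₁ + f ^ N₁ * Q₂,
      rename Fin.castSucc f ^ N₂ * A₁ + rename Fin.castSucc f ^ N₁ * A₂, ?_⟩
    simp only [map_add, map_mul, map_pow]
    linear_combination rename Fin.castSucc f ^ N₂ * h₁ + rename Fin.castSucc f ^ N₁ * h₂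
  | mul_X P k h =>
    obtain ⟨N, Q, A, h⟩ := h
    induction k using Fin.lastCases with
    | cast i =>
      refine ⟨N, Q * X i, A * X i.castSucc, ?_⟩
      simp only [map_mul, rename_X]
      linear_combination X i.castSucc * h
    | last =>
      refine ⟨N + 1, Q * g, rename Fin.castSucc f ^ N * P + A * rename Fin.castSucc g, ?_⟩
      simp only [map_mul]
      rw [monoidEquation] at h ⊢
      linear_combination rename Fin.castSucc g * h

/-- If P vanishes at the parametrization, so does its pseudo-remainder Q, and Q = 0 by injectivity.
Then E divides f^N P; E is prime and cannot divide f, whose value f^{d-1} · f is nonzero. -/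
theorem isImplicitEquation_monoidEquation (hd : 1 ≤ d) (hf : f.IsHomogeneous (d - 1))
    (hg : g.IsHomogeneous d) (hfg : IsRelPrime f g) :
    IsImplicitEquation (monoidParam f g) (monoidEquation f g) := by
  have hf0 := ne_zero_of_isRelPrime hd hg hfg
  have hE := irreducible_monoidEquation hf0 hfg
  have hEu := aeval_monoidEquation hd hf hg
  refine ⟨hE, le_antisymm (fun P hP => ?_) ?_⟩
  · rw [RingHom.mem_ker] at hP
    obtain ⟨N, Q, hQ⟩ := exists_monoidEquation_dvd f g P
    have hQ0 : Q = 0 := by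
      apply aeval_X_mul_injective hd hf hf0
      have := map_dvd (aeval (monoidParam f g)) hQ
      rw [hEu, zero_dvd_iff] at this
      rw [map_sub, map_mul, hP, mul_zero, zero_sub, neg_eq_zero, aeval_monoidParam_rename] at this
      rw [this, map_zero]
    rw [hQ0, map_zero, sub_zero] at hQ
    rw [Ideal.mem_span_singleton]
    refine (hE.prime.dvd_or_dvd hQ).resolve_left fun h => ?_
    have := map_dvd (aeval (monoidParam f g)) (hE.prime.dvd_of_dvd_pow h)
    rw [hEu, zero_dvd_iff, aeval_monoidParam_rename, aeval_X_mul_eq hf] at this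
    exact mul_ne_zero (pow_ne_zero _ hf0) hf0 this
  · rw [Ideal.span_singleton_le_iff_mem]
    exact hEu

end ImplicitEquation

/-! ### The Rees ideal as a bihomogeneous ideal. -/

section ReesMap

/-- The evaluation `t_i ↦ t_i`, `X_k ↦ u_k`. -/
def evalParam (u : Fin (n + 1) → MvPolynomial (Fin n) K) :
    TX K n →ₐ[K] MvPolynomial (Fin n) K :=
  aeval (Sum.elim X u)

theorem coe_reesMap (u : Fin (n + 1) → MvPolynomial (Fin n) K) (p : TX K n) :
    (reesMap u p : Polynomial (MvPolynomial (Fin n) K)) =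
      aeval (Sum.elim (fun i => Polynomial.C (X i)) fun k => Polynomial.monomial 1 (u k)) p := by
  let v : reesAlgebra (Ideal.span (Set.range u)) →ₐ[K] Polynomial (MvPolynomial (Fin n) K) :=
    (reesAlgebra (Ideal.span (Set.range u))).val.restrictScalars K
  have : v.comp (reesMap u) =
      aeval (Sum.elim (fun i => Polynomial.C (X i)) fun k => Polynomial.monomial 1 (u k)) := by
    ext (i | k) : 1
    · simp [reesMap, v]
    · simp [reesMap, v]
  exact DFunLike.congr_fun this p

theorem mem_reesIdeal_iff {u : Fin (n + 1) → MvPolynomial (Fin n) K} {p : TX K n} :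
    p ∈ reesIdeal u ↔ (reesMap u p : Polynomial (MvPolynomial (Fin n) K)) = 0 := by
  rw [reesIdeal, RingHom.mem_ker, ZeroMemClass.coe_eq_zero]

theorem coe_reesMap_eq_monomial (u : Fin (n + 1) → MvPolynomial (Fin n) K) {p : TX K n} {a b : ℕ}
    (hp : IsWeightedHomogeneous (bidegree n) p (a, b)) :
    (reesMap u p : Polynomial (MvPolynomial (Fin n) K)) =
      Polynomial.monomial b (evalParam u p) := by
  have h := aeval_pow_mul (Polynomial.X : Polynomial (MvPolynomial (Fin n) K))
    (fun k => Polynomial.C (Sum.elim X u k)) (isBihomogeneous_iff.mpr hp).2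
  have hC : aeval (fun k => Polynomial.C (Sum.elim X u k)) p = Polynomial.C (evalParam u p) := by
    rw [evalParam]
    exact (comp_aeval_apply (Sum.elim X u)
      ((Polynomial.CAlgHom (R := MvPolynomial (Fin n) K)).restrictScalars K) p).symm
  rw [coe_reesMap, ← Polynomial.C_mul_X_pow_eq_monomial, mul_comm, ← hC, ← h]
  congr 2
  ext1 (i | k)
  · simp
  · simp only [Sum.elim_inr, pow_one]
    rw [mul_comm, Polynomial.C_mul_X_eq_monomial]

theorem mem_reesIdeal_iff_evalParam {u : Fin (n + 1) → MvPolynomial (Fin n) K} {p : TX K n}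
    {a b : ℕ} (hp : IsWeightedHomogeneous (bidegree n) p (a, b)) :
    p ∈ reesIdeal u ↔ evalParam u p = 0 := by
  rw [mem_reesIdeal_iff, coe_reesMap_eq_monomial u hp, Polynomial.monomial_eq_zero_iff]

theorem isHomogeneous_evalParam {u : Fin (n + 1) → MvPolynomial (Fin n) K} {d : ℕ}
    (hu : ∀ k, (u k).IsHomogeneous d) {p : TX K n} {a b : ℕ}
    (hp : IsWeightedHomogeneous (bidegree n) p (a, b)) :
    (evalParam u p).IsHomogeneous (a + d * b) :=
  isWeightedHomogeneous_aeval (w' := 1)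
    (AddMonoidHom.coprod (.id ℕ) (AddMonoidHom.mulLeft d)) (by
      rintro (i | k)
      · have : (X i : MvPolynomial (Fin n) K).IsHomogeneous (1 + d * 0) := isHomogeneous_X K i
        exact this
      · have : (u k).IsHomogeneous (0 + d * 1) := by simpa using hu k
        exact this) hp

/-- Bidegree (a, b) is recovered from the image: b is the exponent of Z and a + db the degree of its
coefficient. Hence the Rees ideal contains the components of its elements. -/
theorem homogeneousComponent_coeff_reesMap {u : Fin (n + 1) → MvPolynomial (Fin n) K} {d : ℕ}
    (hu : ∀ k, (u k).IsHomogeneous d) (a b : ℕ) (p : TX K n) :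
    homogeneousComponent (a + d * b)
        ((reesMap u p : Polynomial (MvPolynomial (Fin n) K)).coeff b) =
      evalParam u (weightedHomogeneousComponent (bidegree n) (a, b) p) := by
  induction p using MvPolynomial.induction_on' with
  | add p q hp hq =>
    simp only [map_add, Subalgebra.coe_add, Polynomial.coeff_add, hp, hq]
  | monomial e r =>
    obtain ⟨⟨a', b'⟩, h⟩ : ∃ D, Finsupp.weight (bidegree n) e = D := ⟨_, rfl⟩
    have he := isWeightedHomogeneous_monomial (bidegree n) e r h
    rw [coe_reesMap_eq_monomial u he, weightedHomogeneousComponent_of_mem he,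
      Polynomial.coeff_monomial]
    by_cases hb : b' = b
    · subst hb
      rw [if_pos rfl, homogeneousComponent_of_mem (isHomogeneous_evalParam hu he)]
      by_cases ha : a = a'
      · simp [ha]
      · simp [ha]
    · simp [hb, Ne.symm hb]

theorem weightedHomogeneousComponent_mem_reesIdeal {u : Fin (n + 1) → MvPolynomial (Fin n) K}
    {d : ℕ} (hu : ∀ k, (u k).IsHomogeneous d) {p : TX K n} (hp : p ∈ reesIdeal u) (a b : ℕ) :
    weightedHomogeneousComponent (bidegree n) (a, b) p ∈ reesIdeal u := by
  rw [mem_reesIdeal_iff_evalParam (weightedHomogeneousComponent_isWeightedHomogeneous _ _),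
    ← homogeneousComponent_coeff_reesMap hu, mem_reesIdeal_iff.mp hp, Polynomial.coeff_zero,
    map_zero]

theorem isHomogeneous_monoidParam {d : ℕ} {f g : MvPolynomial (Fin n) K} (hd : 1 ≤ d)
    (hf : f.IsHomogeneous (d - 1)) (hg : g.IsHomogeneous d) (k : Fin (n + 1)) :
    (monoidParam f g k).IsHomogeneous d := by
  induction k using Fin.lastCases with
  | last => simpa [monoidParam] using hg
  | cast i =>
    have := (isHomogeneous_X K i).mul hf
    rw [Nat.add_sub_cancel' hd] at this
    simpa [monoidParam] using this

theorem aeval_monoidParam_collapse {f g : MvPolynomial (Fin n) K} {p : TX K n} {a b : ℕ}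
    (hp : IsWeightedHomogeneous (bidegree n) p (a, b)) :
    aeval (monoidParam f g) (collapse K n p) = f ^ a * evalParam (monoidParam f g) p := by
  rw [collapse, aeval_rename, evalParam,
    ← aeval_pow_mul f (Sum.elim X (monoidParam f g)) (isBihomogeneous_iff.mpr hp).1]
  congr 2
  ext1 (i | k)
  · simp [monoidParam, mul_comm]
  · simp

end ReesMap

end MonoidRees

end

noncomputable section

namespace MonoidRees

variable {K : Type*} [Field K] {n d : ℕ} {f g : MvPolynomial (Fin n) K} {F : ℕ → TX K n}

/-! ### The sequences F_{d-1}, …, F_0. -/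

section Sequence

theorem isWeightedHomogeneous_start (hf : f.IsHomogeneous (d - 1))
    {a : Fin n → MvPolynomial (Fin n) K} (ha : ∀ i, (a i).IsHomogeneous (d - 1)) :
    IsWeightedHomogeneous (bidegree n)
      (ofT f * xVar K (Fin.last n) - ∑ i, ofT (a i) * xVar K i.castSucc) (d - 1, 1) :=
  ((isWeightedHomogeneous_ofT hf).mul (isWeightedHomogeneous_xVar (Fin.last n))).sub
    (isWeightedHomogeneous_sum_mul_xVar fun i => isWeightedHomogeneous_ofT (ha i))

theorem exists_isMonoidSequence (hd : 1 ≤ d) (hf : f.IsHomogeneous (d - 1))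
    (hg : g.IsHomogeneous d) : ∃ F : ℕ → TX K n, IsMonoidSequence d f g F := by
  rw [← Nat.sub_add_cancel hd] at hg
  obtain ⟨a, ha, hga⟩ := exists_eq_sum_X_mul hg
  -- Stated for every p, so that `choose` yields a total successor function to iterate; the index k
  -- = d - 1 - j counts upwards.
  have hstep (p : TX K n) (k : ℕ) : ∃ q : TX K n, ∀ j, j + (k + 2) = d →
      IsWeightedHomogeneous (bidegree n) p (j + 1, k + 1) →
      IsWeightedHomogeneous (bidegree n) q (j, k + 2) ∧
      ∃ G : Fin n → TX K n, (∀ i, IsWeightedHomogeneous (bidegree n) (G i) (j, k + 1)) ∧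
        p = ∑ i, G i * tVar K i ∧ q = ∑ i, G i * xVar K i.castSucc := by
    by_cases h : ∃ j, j + (k + 2) = d ∧ IsWeightedHomogeneous (bidegree n) p (j + 1, k + 1)
    · obtain ⟨j, hj, hp⟩ := h
      obtain ⟨G, hG, hpG⟩ := exists_eq_sum_mul_tVar hp
      refine ⟨∑ i, G i * xVar K i.castSucc, fun j' hj' _ => ?_⟩
      obtain rfl : j' = j := by omega
      exact ⟨isWeightedHomogeneous_sum_mul_xVar hG, G, hG, hpG, rfl⟩
    · exact ⟨0, fun j hj hp => (h ⟨j, hj, hp⟩).elim⟩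
  choose next hnext using hstep
  let H (k : ℕ) : TX K n := Nat.rec
    (ofT f * xVar K (Fin.last n) - ∑ i, ofT (a i) * xVar K i.castSucc) (fun k p => next p k) k
  have hH (k j : ℕ) (hk : j + (k + 1) = d) :
      IsWeightedHomogeneous (bidegree n) (H k) (j, k + 1) := by
    induction k generalizing j with
    | zero =>
      obtain rfl : j = d - 1 := by omega
      exact isWeightedHomogeneous_start hf ha
    | succ k ih => exact (hnext (H k) k j hk (ih (j + 1) (by omega))).1
  refine ⟨fun j => H (d - 1 - j), ⟨a, ha, hga, by simp [H]⟩, fun j hj => ?_⟩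
  obtain ⟨k, rfl⟩ : ∃ k, d = j + (k + 2) := ⟨d - j - 2, by omega⟩
  obtain ⟨-, G, hG, h₁, h₂⟩ := hnext (H k) k j rfl (hH k (j + 1) (by omega))
  refine ⟨G, fun i => ?_, ?_, ?_⟩
  · rw [isBihomogeneous_iff, show j + (k + 2) - (j + 1) = k + 1 by omega]
    exact hG i
  · simp only [show j + (k + 2) - 1 - (j + 1) = k by omega]
    exact h₁
  · simp only [show j + (k + 2) - 1 - j = k + 1 by omega]
    exact h₂

theorem IsMonoidSequence.isWeightedHomogeneous (hF : IsMonoidSequence d f g F)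
    (hf : f.IsHomogeneous (d - 1)) {j : ℕ} (hj : j < d) :
    IsWeightedHomogeneous (bidegree n) (F j) (j, d - j) := by
  by_cases hj' : j + 1 < d
  · obtain ⟨G, hG, -, h⟩ := hF.step j hj'
    rw [h, show d - j = d - (j + 1) + 1 by omega]
    exact isWeightedHomogeneous_sum_mul_xVar fun i => isBihomogeneous_iff.mp (hG i)
  · obtain ⟨a, ha, -, h⟩ := hF.start
    obtain rfl : j = d - 1 := by omega
    rw [h, show d - (d - 1) = 1 by omega]
    exact isWeightedHomogeneous_start hf ha

theorem IsMonoidSequence.collapse_eq (hF : IsMonoidSequence d f g F) {j : ℕ} (hj : j < d) :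
    collapse K n (F j) = monoidEquation f g := by
  obtain ⟨k, hk⟩ : ∃ k, j + k + 1 = d := ⟨d - 1 - j, by omega⟩
  induction k generalizing j with
  | zero =>
    obtain ⟨a, -, hga, h⟩ := hF.start
    obtain rfl : j = d - 1 := by omega
    simp [h, hga, monoidEquation, mul_comm]
  | succ k ih =>
    obtain ⟨G, -, h₁, h₂⟩ := hF.step j (by omega)
    rw [← ih (j := j + 1) (by omega) (by omega), h₁, h₂]
    simp

theorem eq_ofX_collapse {p : TX K n} {b : ℕ}
    (hp : IsWeightedHomogeneous (bidegree n) p (0, b)) : p = ofX (collapse K n p) := by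
  have h := aeval_pow_mul (0 : TX K n) X (isBihomogeneous_iff.mpr hp).1
  rw [pow_zero, one_mul, aeval_X_left_apply] at h
  -- `ρ` kills every t_i and fixes every X_k; scaling by 0 shows that it fixes p, which has t-degree
  -- 0.
  set ρ : TX K n →ₐ[K] TX K n := aeval fun k => 0 ^
    (Sum.elim (fun _ => 1) (fun _ => 0) : Fin n ⊕ Fin (n + 1) → ℕ) k * X k
  have hρ : ((rename Sum.inr).comp (collapse K n)).comp ρ = ρ := by
    ext (i | k) : 1 <;> simp [ρ, collapse]
  have := DFunLike.congr_fun hρ p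
  simp only [AlgHom.comp_apply, h] at this
  exact this.symm

theorem eq_zero_of_collapse_eq_zero {p : TX K n}
    (hp : IsWeightedHomogeneous
      (Sum.elim (fun _ => 0) (fun _ => 1) : Fin n ⊕ Fin (n + 1) → ℕ) p 0)
    (h0 : collapse K n p = 0) : p = 0 := by
  have h := aeval_pow_mul (0 : TX K n) X hp
  rw [pow_zero, one_mul, aeval_X_left_apply] at h
  set ρ : TX K n →ₐ[K] TX K n := aeval fun k => 0 ^
    (Sum.elim (fun _ => 0) (fun _ => 1) : Fin n ⊕ Fin (n + 1) → ℕ) k * X k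
  have hρ : ((aeval (Fin.snoc (α := fun _ => TX K n) (fun i => X (Sum.inl i)) 0)).comp
      (collapse K n)).comp ρ = ρ := by
    ext (i | k) : 1 <;> simp [ρ, collapse]
  have := DFunLike.congr_fun hρ p
  simp only [AlgHom.comp_apply, h, h0, map_zero] at this
  exact this.symm

end Sequence

/-! ### Generation of the Rees ideal. -/

section Generation

theorem mem_reesIdeal_iff_dvd_collapse (hd : 1 ≤ d) (hf : f.IsHomogeneous (d - 1))
    (hg : g.IsHomogeneous d) (hfg : IsRelPrime f g) {p : TX K n} {a b : ℕ}
    (hp : IsWeightedHomogeneous (bidegree n) p (a, b)) :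
    p ∈ reesIdeal (monoidParam f g) ↔ monoidEquation f g ∣ collapse K n p := by
  rw [← Ideal.mem_span_singleton, ← (isImplicitEquation_monoidEquation hd hf hg hfg).2,
    RingHom.mem_ker, aeval_monoidParam_collapse hp, mem_reesIdeal_iff_evalParam hp,
    mul_eq_zero_iff_left (pow_ne_zero a (ne_zero_of_isRelPrime hd hg hfg))]

/-- A monomial of degree `a + b` whose degree in `X_{n+1}` is at most `b` lifts to bidegree
`(a, b)`. -/
theorem exists_collapse_eq_monomial {a b : ℕ} {e : Fin (n + 1) →₀ ℕ} (he : e.degree = a + b)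
    (hl : e (Fin.last n) ≤ b) (r : K) :
    ∃ q : TX K n, IsWeightedHomogeneous (bidegree n) q (a, b) ∧
      collapse K n q = monomial e r := by
  -- Lift first with as many t's as possible, keeping only X_{n+1}; the surplus b - e_{n+1} is then
  -- moved from t to X.
  let w : Fin (n + 1) → ℕ × ℕ := Fin.snoc (α := fun _ => ℕ × ℕ) (fun _ => (1, 0)) (0, 1)
  let c : Fin (n + 1) → Fin n ⊕ Fin (n + 1) :=
    Fin.snoc (α := fun _ => Fin n ⊕ Fin (n + 1)) Sum.inl (Sum.inr (Fin.last n))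
  have hdeg : (∑ i : Fin n, e i.castSucc) + e (Fin.last n) = a + b := by
    rw [← he, Finsupp.degree_eq_sum, Fin.sum_univ_castSucc]
  have hw : Finsupp.weight w e = (a + (b - e (Fin.last n)), e (Fin.last n)) := by
    rw [Finsupp.weight_apply, Finsupp.sum_fintype _ _ (by simp), Fin.sum_univ_castSucc]
    ext
    · simp [w, Prod.fst_sum]; omega
    · simp [w, Prod.snd_sum]
  have hm := isWeightedHomogeneous_rename (w' := bidegree n) (c := c) (AddMonoidHom.id (ℕ × ℕ))
    (fun k => by induction k using Fin.lastCases <;> simp [w, c, bidegree])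
    (isWeightedHomogeneous_monomial w e r hw)
  obtain ⟨q, hq, h⟩ := exists_collapse_eq hm
  refine ⟨q, by rwa [Nat.sub_add_cancel hl] at hq, h.trans ?_⟩
  have hc : Sum.elim Fin.castSucc id ∘ c = id := by
    ext1 k
    induction k using Fin.lastCases <;> simp [c]
  rw [collapse, rename_rename, hc, rename_id_apply]

theorem degreeOf_last_collapse_le {p : TX K n} {a b : ℕ}
    (hp : IsWeightedHomogeneous (bidegree n) p (a, b)) :
    degreeOf (Fin.last n) (collapse K n p) ≤ b := by
  classical
  rw [degreeOf_le_iff]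
  intro e he
  obtain ⟨m, rfl, hm⟩ := coeff_rename_ne_zero _ _ _ (mem_support_iff.mp he)
  have := hp hm
  rw [weight_bidegree, Prod.mk.injEq] at this
  rw [sum_elim_mapDomain_last, ← this.2]
  exact Finset.single_le_sum (f := fun k => m (Sum.inr k)) (fun _ _ => Nat.zero_le _)
    (Finset.mem_univ (Fin.last n))

theorem mem_of_monoidEquation_dvd_collapse (hd : 1 ≤ d) (hf : f.IsHomogeneous (d - 1))
    (hg : g.IsHomogeneous d) (hf0 : f ≠ 0) (hF : IsMonoidSequence d f g F) {I : Ideal (TX K n)}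
    (hI : minorIdeal K n ≤ I) (hFI : ∀ j < d, F j ∈ I) {p : TX K n} {a b : ℕ}
    (hp : IsWeightedHomogeneous (bidegree n) p (a, b))
    (hE : monoidEquation f g ∣ collapse K n p) : p ∈ I := by
  classical
  by_cases h0 : collapse K n p = 0
  · exact hI (mem_minorIdeal_of_collapse_eq_zero hp h0)
  have hEh := isHomogeneous_monoidEquation hd hf hg
  have hcol := isHomogeneous_collapse hp
  obtain ⟨Q, hQ, hQh⟩ : ∃ Q, collapse K n p = Q * monoidEquation f g ∧
      ∀ e ∈ Q.support, e.degree + d = a + b := by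
    obtain ⟨Q, hQ⟩ := hE
    rw [mul_comm] at hQ
    by_cases hab : d ≤ a + b
    · refine ⟨homogeneousComponent (a + b - d) Q, ?_, fun e he => ?_⟩
      · have := weightedHomogeneousComponent_add_mul hEh (a + b - d) Q
        rw [Nat.sub_add_cancel hab, ← hQ,
          IsWeightedHomogeneous.weightedHomogeneousComponent_same hcol] at this
        exact this
      · have : e.degree = a + b - d := by
          by_contra hne
          exact mem_support_iff.mp he
            ((homogeneousComponent_isHomogeneous (a + b - d) Q).coeff_eq_zero hne)
        omega
    · have := weightedHomogeneousComponent_mul_eq_zero hEh (D := a + b) (by omega) Q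
      rw [← hQ, IsWeightedHomogeneous.weightedHomogeneousComponent_same hcol] at this
      exact (h0 this).elim
  have hQ0 : Q ≠ 0 ∧ monoidEquation f g ≠ 0 := by
    rwa [← mul_ne_zero_iff, ← hQ]
  -- E uses up at least one degree in X_{n+1}; this is what makes m < d below.
  have hdeg : degreeOf (Fin.last n) Q + 1 ≤ b := by
    have h₁ := degreeOf_last_collapse_le hp
    rw [hQ, degreeOf_mul_eq hQ0.1 hQ0.2] at h₁
    have h₂ := one_le_degreeOf_monoidEquation (g := g) hf0
    omega
  have hlift : ∀ e ∈ Q.support, ∃ q : TX K n, q ∈ I ∧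
      IsWeightedHomogeneous (bidegree n) q (a, b) ∧
      collapse K n q = monomial e (coeff e Q) * monoidEquation f g := by
    intro e he
    have h₁ := hQh e he
    have h₂ := (monomial_le_degreeOf (Fin.last n) he).trans (Nat.le_sub_one_of_lt hdeg)
    have hle : e (Fin.last n) ≤ e.degree := Finsupp.le_degree _ _
    -- The least m for which the cofactor of F_m, of X-degree b - (d - m), has room for the
    -- X_{n+1}-exponent of e; truncated subtraction gives m = 0 when F_0 already works.
    obtain ⟨m, hm⟩ : ∃ m, m = e (Fin.last n) + d - b := ⟨_, rfl⟩
    obtain ⟨q, hq, hqe⟩ := exists_collapse_eq_monomial (a := a - m) (b := b - (d - m)) (e := e)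
      (by omega) (by omega) (coeff e Q)
    refine ⟨q * F m, I.mul_mem_left _ (hFI m (by omega)), ?_, ?_⟩
    · have := hq.mul (hF.isWeightedHomogeneous hf (j := m) (by omega))
      rwa [Prod.mk_add_mk, Nat.sub_add_cancel (by omega), Nat.sub_add_cancel (by omega)] at this
    · rw [map_mul, hqe, hF.collapse_eq (by omega)]
  choose! q hqI hqh hqc using hlift
  have hsub : p - ∑ e ∈ Q.support, q e ∈ minorIdeal K n := by
    refine mem_minorIdeal_of_collapse_eq_zero
      (hp.sub (IsWeightedHomogeneous.sum _ _ _ fun e he => hqh e he)) ?_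
    rw [map_sub, map_sum, Finset.sum_congr rfl hqc, ← Finset.sum_mul, support_sum_monomial_coeff,
      hQ, sub_self]
  simpa using add_mem (hI hsub) (sum_mem hqI)

theorem span_monoidGenerators (hd : 1 ≤ d) (hf : f.IsHomogeneous (d - 1))
    (hg : g.IsHomogeneous d) (hfg : IsRelPrime f g) (hF : IsMonoidSequence d f g F) :
    Ideal.span (Set.range (monoidGenerators d F)) = reesIdeal (monoidParam f g) := by
  apply le_antisymm
  · rw [Ideal.span_le]
    rintro _ ⟨q | j, rfl⟩
    · refine (mem_reesIdeal_iff_dvd_collapse hd hf hg hfg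
        (isWeightedHomogeneous_minor q.1.1 q.1.2)).mpr ?_
      simp
    · refine (mem_reesIdeal_iff_dvd_collapse hd hf hg hfg
        (hF.isWeightedHomogeneous hf j.2)).mpr ?_
      rw [hF.collapse_eq j.2]
  · intro p hp
    rw [← sum_weightedHomogeneousComponent (bidegree n) p,
      finsum_eq_sum _ (weightedHomogeneousComponent_finsupp p)]
    refine sum_mem fun D _ => ?_
    obtain ⟨a, b⟩ := D
    have hc := weightedHomogeneousComponent_isWeightedHomogeneous (w := bidegree n) (a, b) p
    refine mem_of_monoidEquation_dvd_collapse hd hf hg (ne_zero_of_isRelPrime hd hg hfg) hF ?_ ?_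
      hc ((mem_reesIdeal_iff_dvd_collapse hd hf hg hfg hc).mp
        (weightedHomogeneousComponent_mem_reesIdeal (isHomogeneous_monoidParam hd hf hg) hp a b))
    · rw [minorIdeal, Ideal.span_le]
      rintro _ ⟨q, rfl⟩
      exact Ideal.subset_span ⟨Sum.inl q, rfl⟩
    · exact fun j hj => Ideal.subset_span ⟨Sum.inr ⟨j, hj⟩, rfl⟩

end Generation

/-! ### Minimality of the generators. -/

section Minimality

/-- A homogeneous element of the span is a combination whose coefficients are homogeneous of the
complementary degrees, so only generators with such a degree count. `T` need only be an additive
submonoid because the induction carries all multiples of x. -/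
theorem mem_of_mem_span_of_isWeightedHomogeneous {σ R M : Type*} [CommRing R]
    [AddCancelCommMonoid M] {w : σ → M} {S : Set (MvPolynomial σ R)}
    {T : AddSubmonoid (MvPolynomial σ R)} {D : M}
    (hS : ∀ s ∈ S, ∃ m, IsWeightedHomogeneous w s m ∧
      ∀ k, k + m = D → ∀ c, IsWeightedHomogeneous w c k → c * s ∈ T)
    {x : MvPolynomial σ R} (hx : IsWeightedHomogeneous w x D) (hxS : x ∈ Ideal.span S) :
    x ∈ T := by
  have key : ∀ c, weightedHomogeneousComponent w D (c * x) ∈ T := by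
    clear hx
    induction hxS using Submodule.span_induction with
    | mem s hs =>
      intro c
      obtain ⟨m, hm, h⟩ := hS s hs
      by_cases hk : ∃ k, k + m = D
      · obtain ⟨k, rfl⟩ := hk
        rw [weightedHomogeneousComponent_add_mul hm]
        exact h k rfl _ (weightedHomogeneousComponent_isWeightedHomogeneous _ _)
      · rw [weightedHomogeneousComponent_mul_eq_zero hm (not_exists.mp hk)]
        exact zero_mem _
    | zero => simp
    | add x y _ _ hx hy =>
      intro c
      rw [mul_add, map_add]
      exact add_mem (hx c) (hy c)
    | smul a x _ hx =>
      intro c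
      rw [smul_eq_mul, ← mul_assoc]
      exact hx _
  have := key 1
  rwa [one_mul, hx.weightedHomogeneousComponent_same] at this

theorem sequence_notMem_span (hF : IsMonoidSequence d f g F) (hf : f.IsHomogeneous (d - 1))
    (hE : monoidEquation f g ≠ 0) (j : Fin d) :
    F j ∉ Ideal.span (monoidGenerators d F '' {Sum.inr j}ᶜ) := by
  intro h
  have := mem_of_mem_span_of_isWeightedHomogeneous
    (T := (RingHom.ker (collapse K n)).toAddSubmonoid) ?_ (hF.isWeightedHomogeneous hf j.2) h
  · exact hE ((hF.collapse_eq j.2).symm.trans this)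
  rintro _ ⟨q | k, hk, rfl⟩
  · refine ⟨_, isWeightedHomogeneous_minor q.1.1 q.1.2, fun _ _ c _ => ?_⟩
    change collapse K n (c * minor K q.1.1 q.1.2) = 0
    simp
  · refine ⟨_, hF.isWeightedHomogeneous hf k.2, fun D hD => ?_⟩
    rw [Prod.ext_iff] at hD
    simp only [Prod.fst_add, Prod.snd_add] at hD
    refine (hk ?_).elim
    have := k.2
    have := j.2
    -- k ≤ j and d - k ≤ d - j force k = j.
    rw [Set.mem_singleton_iff, Sum.inr.injEq, Fin.ext_iff]
    omega

theorem minor_notMem_span_minor (q : {q : Fin n × Fin n // q.1 < q.2}) :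
    minor K q.1.1 q.1.2 ∉ Ideal.span
      ((fun q : {q : Fin n × Fin n // q.1 < q.2} => minor K q.1.1 q.1.2) '' {q}ᶜ) := by
  classical
  obtain ⟨⟨i, j⟩, hij⟩ := q
  intro h
  -- At t = e_i, X = e_j, the minor p_{ij} is 1 and all the others vanish.
  let φ : TX K n →ₐ[K] K := aeval (Sum.elim (Pi.single i 1) (Pi.single j.castSucc 1))
  have hφ (k l : Fin n) : φ (minor K k l) =
      (if k = i ∧ l = j then 1 else 0) - if l = i ∧ k = j then 1 else 0 := by
    simp [φ, minor, tVar, xVar, Pi.single_apply, ← ite_and, and_comm]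
  have hker : Ideal.span ((fun q : {q : Fin n × Fin n // q.1 < q.2} =>
      minor K q.1.1 q.1.2) '' {⟨(i, j), hij⟩}ᶜ) ≤ RingHom.ker φ := by
    rw [Ideal.span_le]
    rintro _ ⟨⟨⟨k, l⟩, hkl⟩, hne, rfl⟩
    change φ (minor K k l) = 0
    dsimp only at hij hkl
    rw [hφ, if_neg, if_neg, sub_zero]
    · rintro ⟨rfl, rfl⟩
      exact lt_asymm hij hkl
    · rintro ⟨rfl, rfl⟩
      exact hne rfl
  have h1 : φ (minor K i j) = 0 := hker h
  rw [hφ, if_pos ⟨rfl, rfl⟩, if_neg, sub_zero] at h1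
  · exact one_ne_zero h1
  · rintro ⟨h, -⟩
    exact hij.ne' h

theorem minor_notMem_span (hF : IsMonoidSequence d f g F) (hd : 1 ≤ d)
    (hf : f.IsHomogeneous (d - 1)) (hE : monoidEquation f g ≠ 0)
    (q : {q : Fin n × Fin n // q.1 < q.2}) :
    minor K q.1.1 q.1.2 ∉ Ideal.span (monoidGenerators d F '' {Sum.inl q}ᶜ) := by
  intro h
  set J := Ideal.span
    ((fun q : {q : Fin n × Fin n // q.1 < q.2} => minor K q.1.1 q.1.2) '' {q}ᶜ) with hJ
  let W := weightedHomogeneousSubmodule K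
    (Sum.elim (fun _ => 0) (fun _ => 1) : Fin n ⊕ Fin (n + 1) → ℕ) 0
  have key := mem_of_mem_span_of_isWeightedHomogeneous
    -- X-degree 1 leaves only F_{d-1}, with a coefficient B free of X; `collapse` is injective on
    -- such B.
    (T := J.toAddSubmonoid ⊔ W.toAddSubmonoid.map (AddMonoidHom.mulRight (F (d - 1)))) ?_
    (isWeightedHomogeneous_minor q.1.1 q.1.2) h
  · obtain ⟨P, hP, _, ⟨B, hB, rfl⟩, hPB⟩ := AddSubmonoid.mem_sup.mp key
    have hPJ : P ∈ J := hP
    have hPker : collapse K n P = 0 := by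
      have : J ≤ RingHom.ker (collapse K n) := by
        rw [hJ, Ideal.span_le]
        rintro _ ⟨q, -, rfl⟩
        exact collapse_minor _ _
      exact this hPJ
    have hB0 : B = 0 := by
      refine eq_zero_of_collapse_eq_zero hB ?_
      have := congrArg (collapse K n) hPB
      rw [map_add, hPker, zero_add, AddMonoidHom.mulRight_apply, map_mul,
        hF.collapse_eq (by omega), collapse_minor] at this
      exact (mul_eq_zero.mp this).resolve_right hE
    rw [hB0, map_zero, add_zero] at hPB
    exact minor_notMem_span_minor q (hPB ▸ hPJ)
  rintro _ ⟨q' | k, hk, rfl⟩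
  · refine ⟨_, isWeightedHomogeneous_minor q'.1.1 q'.1.2, fun _ _ c _ => ?_⟩
    refine AddSubmonoid.mem_sup_left (J.mul_mem_left c (Ideal.subset_span ⟨q', ?_, rfl⟩))
    rintro rfl
    exact hk rfl
  · refine ⟨_, hF.isWeightedHomogeneous hf k.2, fun D hD c hc => ?_⟩
    obtain ⟨a, b⟩ := D
    simp only [Prod.mk_add_mk, Prod.mk.injEq] at hD
    have := k.2
    obtain rfl : b = 0 := by omega
    have hkd : (k : ℕ) = d - 1 := by omega
    refine AddSubmonoid.mem_sup_right ⟨c, (isBihomogeneous_iff.mpr hc).2, ?_⟩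
    simp [monoidGenerators, hkd]

end Minimality

end MonoidRees

end

theorem theorem3p1 {K : Type*} [Field K] (n d : ℕ) (hn : 1 ≤ n) (hd : 1 ≤ d)
    (f g : MvPolynomial (Fin n) K)
    (hf : f.IsHomogeneous (d - 1)) (hg : g.IsHomogeneous d) (hfg : IsRelPrime f g) :
    MonoidRees.IsImplicitEquation (MonoidRees.monoidParam f g) (MonoidRees.monoidEquation f g) ∧
    (∃ F : ℕ → MonoidRees.TX K n, MonoidRees.IsMonoidSequence d f g F) ∧
    ∀ F : ℕ → MonoidRees.TX K n, MonoidRees.IsMonoidSequence d f g F →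
      F 0 = MonoidRees.ofX (MonoidRees.monoidEquation f g) ∧
      MonoidRees.IsMinimalGenerators (MonoidRees.reesIdeal (MonoidRees.monoidParam f g))
        (MonoidRees.monoidGenerators d F) := by
  have himp := MonoidRees.isImplicitEquation_monoidEquation hd hf hg hfg
  refine ⟨himp, MonoidRees.exists_isMonoidSequence hd hf hg, fun F hF => ⟨?_, ?_, ?_⟩⟩
  · rw [← hF.collapse_eq hd]
    exact MonoidRees.eq_ofX_collapse (hF.isWeightedHomogeneous hf hd)
  · exact MonoidRees.span_monoidGenerators hd hf hg hfg hF
  · rintro (q | j)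
    · exact MonoidRees.minor_notMem_span hF hd hf himp.1.ne_zero q
    · exact MonoidRees.sequence_notMem_span hF hf himp.1.ne_zero j
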